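/- A temporal graph $\mathcal G=(V,E,\lambda)$ is a graph $(V,E)$ with a finite set $\lambda(e)$ of positive real time labels on each edge $e\in E$. Let $H=(V_H,E_H)$ be a fixed finite simple graph with $|E_H|\ge 2$ and let $P=(E_H,\prec)$ be a strict partial order on its edges; $\mathrm{height}(P)$ is the largest number of elements of a chain of $P$. For real $\delta$, $\mathcal G$ contains $(H,P)$ as a $\delta$-temporal motif if there are a subgraph $(V',E')$ of $(V,E)$, a choice of one label $\lambda'(e)\in\lambda(e)$ for each $e\in E'$, and a graph isomorphism $\Phi:H\to(V',E')$ such that $\lambda'(\Phi(e))<\lambda'(\Phi(f))$ whenever $e\prec f$ in $P$, and $\lambda'(e_1)-\lambda'(e_2)<\delta$ for all $e_1,e_2\in E'$. Put $$\rho_H=\min\left\{\frac{|V_I|}{|E_I|-1}\;:\; I\subseteq H \text{ a subgraph with } |E_I|\ge 2\right\}.$$ Let $\psi$ be a probability distribution on $\{0,1,2,\dots\}$ with positive and finite first and second moments. For a positive integer $T$, the random temporal graph $\Gamma_{[n]}(\psi,T)$ on the vertex set $[n]=\{1,\dots,n\}$ is obtained by taking, independently for each edge $e\in\binom{[n]}{2}$,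 a number $l_e\sim\psi$ and letting $\lambda(e)$ be the set of values of $l_e$ independent samples, each uniform on $\{1,\dots,T\}$. **Theorem.** Let $\beta:\mathbb N\to\mathbb N$ and $T:\mathbb N\to\{1,2,\dots\}$ be functions such that $\beta(n)\le T(n)$ for all $n$, and such that there is $n_0>0$ with $\beta(n)\ge\mathrm{height}(P)$ for all $n\ge n_0$. Then, as $n\to\infty$: 1. if $\beta(n)/T(n)=\omega(n^{-\rho_H})$, the probability that a sample of $\Gamma_{[n]}(\psi,T(n))$ contains $(H,P)$ as a $\beta(n)$-temporal motif tends to $1$; 2. if $\beta(n)/T(n)=o(n^{-\rho_H})$, the probability that a sample of $\Gamma_{[n]}(\psi,T(n))$ does not contain $(H,P)$ as a $\beta(n)$-temporal motif tends to $1$. -/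

import Mathlib

open Filter Topology Asymptotics MeasureTheory
open scoped ENNReal

/-- A temporal graph on the vertex set `V`: an underlying static graph, together with a finite set
of positive real time labels on each edge. -/
structure TemporalGraph (V : Type*) where
  graph : SimpleGraph V
  labels : graph.edgeSet → Finset ℝ
  labels_pos : ∀ e, ∀ t ∈ labels e, 0 < t

namespace TemporalGraph

/-- `G` contains `(H, P)` as a `δ`-temporal motif, where `P` is a strict order on the edges of `H`:
there are a subgraph `S` of the underlying graph, a choice `lab` of one label of `G` for each edge
of `S`, and an isomorphism `Φ` from `H` onto `S`, such that the chosen labels realize `P`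
and any two of them differ by less than `δ`. -/
def ContainsMotif {V W : Type*} (G : TemporalGraph V) (H : SimpleGraph W)
    (P : H.edgeSet → H.edgeSet → Prop) (δ : ℝ) : Prop :=
  ∃ (S : G.graph.Subgraph) (lab : S.coe.edgeSet → ℝ) (Φ : H ≃g S.coe),
    (∀ e, lab e ∈ G.labels (S.hom.mapEdgeSet e)) ∧
    (∀ e f : H.edgeSet, P e f → lab (Φ.mapEdgeSet e) < lab (Φ.mapEdgeSet f)) ∧
    (∀ e f : S.coe.edgeSet, lab e - lab f < δ)

/-- The temporal graph on the complete graph with prescribed (possibly empty) sets of positive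
integer labels on the edges. -/
noncomputable def ofLabels {V : Type*}
    (L : (⊤ : SimpleGraph V).edgeSet → Finset ℕ+) : TemporalGraph V where
  graph := ⊤
  labels e := (L e).image fun t : ℕ+ => ((t : ℕ) : ℝ)
  labels_pos := by
    intro e t ht
    obtain ⟨s, -, rfl⟩ := Finset.mem_image.mp ht
    exact Nat.cast_pos.mpr s.pos

/-- Every set of temporal graphs is an event. -/
instance instMeasurableSpace (V : Type*) : MeasurableSpace (TemporalGraph V) := ⊤

end TemporalGraph

/-- The sparsity `ρ_H`: the minimum of `|V_I| / (|E_I| - 1)` over the subgraphs `I` of `H` with at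
least two edges. For a finite graph with at least two edges this is an infimum over a finite
nonempty set. -/
noncomputable def sparsity {W : Type*} (H : SimpleGraph W) : ℝ :=
  sInf {x : ℝ | ∃ I : H.Subgraph, 2 ≤ I.edgeSet.ncard ∧
    x = (I.verts.ncard : ℝ) / ((I.edgeSet.ncard : ℝ) - 1)}

/-- The moment `E[Q ^ j]` of `Q ∼ ψ`, as an extended nonnegative real. -/
noncomputable def labelMoment (ψ : PMF ℕ) (j : ℕ) : ℝ≥0∞ :=
  ∑' k : ℕ, ψ k * (k : ℝ≥0∞) ^ j

/-- A label multiplicity distribution: a distribution on the nonnegative integers with positive and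
finite first and second moments. -/
def IsLabelMultiplicity (ψ : PMF ℕ) : Prop :=
  (0 < labelMoment ψ 1 ∧ labelMoment ψ 1 < ⊤) ∧ (0 < labelMoment ψ 2 ∧ labelMoment ψ 2 < ⊤)

/-- The uniform distribution on `{1, …, T}`. -/
noncomputable def uniformLabel (T : ℕ+) : PMF ℕ+ :=
  PMF.uniformOfFinset (Finset.Icc 1 T) ⟨1, Finset.mem_Icc.mpr ⟨le_rfl, one_le⟩⟩

/-- The law of the set of values of `k` independent samples, each uniform on `{1, …, T}`. -/
noncomputable def drawLabels (T : ℕ+) : ℕ → PMF (Finset ℕ+)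
  | 0 => PMF.pure ∅
  | k + 1 => (uniformLabel T).bind fun t => (drawLabels T k).map fun s => insert t s

/-- The law of the label set of one edge: the number of samples is drawn from `ψ`, then that many
independent labels are drawn uniformly from `{1, …, T}`. -/
noncomputable def edgeLaw (ψ : PMF ℕ) (T : ℕ+) : PMF (Finset ℕ+) :=
  ψ.bind (drawLabels T)

/-- The law `Γ_V(ψ, T)` of the discrete doubly random temporal graph: the label sets of the
two-element subsets of `V` are independent, each with law `edgeLaw ψ T`. -/
noncomputable def doublyRandom (V : Type*) [Fintype V] [DecidableEq V] (ψ : PMF ℕ) (T : ℕ+) :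
    Measure (TemporalGraph V) :=
  (Measure.pi fun _ : (⊤ : SimpleGraph V).edgeSet => (edgeLaw ψ T).toMeasure).map
    TemporalGraph.ofLabels

/-!
Let `p = β(n) / T(n)`. The expected number of `β(n)`-temporal copies of a subgraph `I` of `H` is at
most of order `n ^ |V_I| * p ^ (|E_I| - 1)`: one label is free and each of the others must lie
within `β(n)` of it. For a subgraph that attains the sparsity this tends to zero when
`p = o(n ^ (-ρ_H))`, and a motif of `H` contains a motif of `I`.

When `p` is large, cut `{1, …, T(n)}` into disjoint windows of length `β(n)` and each window into
`height(P)` consecutive blocks, and count only those copies of `H` whose edges all have their first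
label in the block, of one common window, given by the rank of the edge in `P`; such a copy is a
motif. Since an edge has only one first label, copies in different windows that share an edge
exclude each other, so in Chebyshev's inequality only the pairs of copies in a common window can
have a positive covariance. Relative to the squared mean, the pairs that share an edge set `J`
contribute the order of `(n ^ |V_J| * p ^ (|J| - 1))⁻¹`, which tends to zero by the definition of
the sparsity.
-/

section Chebyshev

open ProbabilityTheory

variable {Ω ι : Type*} [MeasurableSpace Ω] {μ : Measure Ω} {A B : Set Ω}

theorem memLp_indicator_one [IsFiniteMeasure μ] (hA : MeasurableSet A) (p : ℝ≥0∞) :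
    MemLp (A.indicator (1 : Ω → ℝ)) p μ :=
  memLp_indicator_const p hA (1 : ℝ) (.inr (measure_ne_top _ _))

variable [IsProbabilityMeasure μ]

theorem covariance_indicator_one (hA : MeasurableSet A) (hB : MeasurableSet B) :
    cov[A.indicator (1 : Ω → ℝ), B.indicator 1; μ] = μ.real (A ∩ B) - μ.real A * μ.real B := by
  rw [covariance_eq_sub (memLp_indicator_one hA 2) (memLp_indicator_one hB 2),
    ← Set.inter_indicator_one, integral_indicator_one hA, integral_indicator_one hB,
    integral_indicator_one (hA.inter hB)]

variable [Fintype ι] {E : ι → Set Ω}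

theorem variance_sum_indicator_one_le (hE : ∀ i, MeasurableSet (E i)) (D : Finset (ι × ι))
    (hD : ∀ p ∉ D, μ.real (E p.1 ∩ E p.2) ≤ μ.real (E p.1) * μ.real (E p.2)) :
    Var[∑ i, (E i).indicator (1 : Ω → ℝ); μ] ≤ ∑ p ∈ D, μ.real (E p.1 ∩ E p.2) := by
  classical
  rw [variance_sum fun i => memLp_indicator_one (hE i) 2, ← Fintype.sum_prod_type',
    ← Finset.sum_add_sum_compl D]
  calc _ ≤ ∑ p ∈ D, μ.real (E p.1 ∩ E p.2) + ∑ _ ∈ Dᶜ, (0 : ℝ) := by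
        gcongr with p _ p hp
        · rw [covariance_indicator_one (hE _) (hE _)]
          exact sub_le_self _ (by positivity)
        · rw [covariance_indicator_one (hE _) (hE _)]
          exact sub_nonpos.mpr (hD p (Finset.mem_compl.mp hp))
    _ = _ := by simp

theorem measureReal_iInter_compl_mul_sq_le (hE : ∀ i, MeasurableSet (E i)) (D : Finset (ι × ι))
    (hD : ∀ p ∉ D, μ.real (E p.1 ∩ E p.2) ≤ μ.real (E p.1) * μ.real (E p.2)) :
    μ.real (⋂ i, (E i)ᶜ) * (∑ i, μ.real (E i)) ^ 2 ≤ ∑ p ∈ D, μ.real (E p.1 ∩ E p.2) := by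
  set N : Ω → ℝ := ∑ i, (E i).indicator 1
  have hN : MemLp N 2 μ := memLp_finsetSum' _ fun i _ => memLp_indicator_one (hE i) 2
  have hmean : μ[N] = ∑ i, μ.real (E i) := by
    simp only [N, Finset.sum_apply]
    rw [integral_finsetSum _ fun i _ => (memLp_indicator_one (hE i) 1).integrable le_rfl]
    exact Finset.sum_congr rfl fun i _ => integral_indicator_one (hE i)
  obtain h0 | hpos := (Finset.sum_nonneg fun i _ => measureReal_nonneg :
    0 ≤ ∑ i, μ.real (E i)).eq_or_lt
  · rw [← h0]
    simpa using Finset.sum_nonneg fun _ _ => measureReal_nonneg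
  have hsub : ⋂ i, (E i)ᶜ ⊆ {ω | μ[N] ≤ |N ω - μ[N]|} := by
    intro ω hω
    have hzero : N ω = 0 := by
      simp only [N, Finset.sum_apply]
      exact Finset.sum_eq_zero fun i _ => Set.indicator_of_notMem (Set.mem_iInter.mp hω i) _
    rw [Set.mem_ofPred_eq, hzero, zero_sub, abs_neg]
    exact le_abs_self _
  have hcheb : μ.real (⋂ i, (E i)ᶜ) ≤ Var[N; μ] / μ[N] ^ 2 :=
    ENNReal.toReal_le_of_le_ofReal (div_nonneg (variance_nonneg N μ) (sq_nonneg _))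
      ((measure_mono hsub).trans (meas_ge_le_variance_div_sq hN (hmean ▸ hpos)))
  rw [hmean, le_div_iff₀ (by positivity)] at hcheb
  exact hcheb.trans (variance_sum_indicator_one_le hE D hD)

end Chebyshev

section Cylinder

variable {E E' F X : Type*}

/-- The event that, for every `e`, the coordinate with index `g e` lies in `A e`: a copy, placed
by `g`, of a pattern that prescribes a set for every index in `E`. -/
def cylinderEvent (g : E → F) (A : E → Set X) : Set (F → X) :=
  {z | ∀ e, z (g e) ∈ A e}

theorem cylinderEvent_sumElim (g : E → F) (g' : E' → F) (A : E → Set X) (A' : E' → Set X) :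
    cylinderEvent (Sum.elim g g') (Sum.elim A A') = cylinderEvent g A ∩ cylinderEvent g' A' := by
  ext z
  simp [cylinderEvent]

theorem cylinderEvent_inter_eq_empty {g g' : E → F} {A A' : E → Set X}
    (hg : ∃ e e', g e = g' e') (hA : ∀ e e', Disjoint (A e) (A' e')) :
    cylinderEvent g A ∩ cylinderEvent g' A' = ∅ := by
  obtain ⟨e, e', he⟩ := hg
  refine Set.eq_empty_of_forall_notMem fun z ⟨hz, hz'⟩ => ?_
  exact Set.disjoint_left.mp (hA e e') (hz e) (he ▸ hz' e')

open scoped Classical in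
/-- The indices of the first of two copies whose coordinates are also used by the second copy. -/
noncomputable def sharedIndices [Fintype E] (g g' : E → F) : Finset E :=
  {e | g e ∈ Set.range g'}

theorem mem_sharedIndices [Fintype E] {g g' : E → F} {e : E} :
    e ∈ sharedIndices g g' ↔ ∃ e', g' e' = g e := by
  simp [sharedIndices]

theorem sharedIndices_nonempty [Fintype E] {g g' : E → F} :
    (sharedIndices g g').Nonempty ↔ ∃ e e', g e = g' e' := by
  simp only [Finset.Nonempty, mem_sharedIndices, eq_comm]

variable [MeasurableSpace X]

theorem measurableSet_cylinderEvent [Countable E] (g : E → F) {A : E → Set X}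
    (hA : ∀ e, MeasurableSet (A e)) : MeasurableSet (cylinderEvent g A) := by
  have hiInter : cylinderEvent g A = ⋂ e, (fun z : F → X => z (g e)) ⁻¹' A e := by
    ext z
    simp [cylinderEvent]
  rw [hiInter]
  exact .iInter fun e => measurable_pi_apply (g e) (hA e)

variable [Fintype E] [Fintype E'] [Fintype F] {ν : Measure X} [IsProbabilityMeasure ν]

theorem pi_cylinderEvent {g : E → F} (hg : g.Injective) (A : E → Set X) :
    Measure.pi (fun _ : F => ν) (cylinderEvent g A) = ∏ e, ν (A e) := by
  classical
  have hpi : cylinderEvent g A =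
      (Finset.univ.image g : Set F).pi fun f => ⋂ e, ⋂ _ : g e = f, A e := by
    ext z
    simp only [cylinderEvent, Set.mem_ofPred_eq, Set.mem_pi, Finset.coe_image, Finset.coe_univ,
      Set.image_univ, Set.forall_mem_range, Set.mem_iInter, hg.eq_iff, forall_eq]
  rw [hpi, Measure.pi_pi_finset, Finset.prod_image hg.injOn]
  refine Finset.prod_congr rfl fun e _ => congrArg ν ?_
  ext x
  simp [hg.eq_iff]

theorem pi_real_cylinderEvent {g : E → F} (hg : g.Injective) (A : E → Set X) :
    (Measure.pi fun _ : F => ν).real (cylinderEvent g A) = ∏ e, ν.real (A e) := by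
  simp only [measureReal_def, pi_cylinderEvent hg, ENNReal.toReal_prod]

theorem pi_real_cylinderEvent_inter {g : E → F} {g' : E' → F} (hg : g.Injective)
    (hg' : g'.Injective) (hgg' : ∀ e e', g e ≠ g' e') (A : E → Set X) (A' : E' → Set X) :
    (Measure.pi fun _ : F => ν).real (cylinderEvent g A ∩ cylinderEvent g' A') =
      (∏ e, ν.real (A e)) * ∏ e, ν.real (A' e) := by
  rw [← cylinderEvent_sumElim, pi_real_cylinderEvent (hg.sumElim hg' hgg'), Fintype.prod_sum_type]
  rfl

theorem pi_real_cylinderEvent_inter_le {g g' : E → F} (hg : g.Injective) (hg' : g'.Injective)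
    {A : E → Set X} {s : ℝ} (hA : ∀ e, ν.real (A e) = s) :
    (Measure.pi fun _ : F => ν).real (cylinderEvent g A ∩ cylinderEvent g' A) ≤
      s ^ (2 * Fintype.card E - (sharedIndices g g').card) := by
  classical
  let i : {e // e ∉ sharedIndices g g'} → E := Subtype.val
  have hdisj : ∀ e e', (g ∘ i) e ≠ g' e' := fun e e' h => e.2 (mem_sharedIndices.mpr ⟨e', h.symm⟩)
  calc _ ≤ (Measure.pi fun _ : F => ν).real (cylinderEvent (g ∘ i) (A ∘ i) ∩ cylinderEvent g' A) :=
        measureReal_mono (Set.inter_subset_inter_left _ fun _ (hz : ∀ e, _) e => hz (i e))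
    _ = s ^ (Fintype.card {e // e ∉ sharedIndices g g'}) * s ^ Fintype.card E := by
        rw [pi_real_cylinderEvent_inter (hg.comp Subtype.val_injective) hg' hdisj]
        simp only [Function.comp_apply, hA, Finset.prod_const, Finset.card_univ]
    _ = _ := by
        rw [← pow_add, Fintype.card_subtype_compl, Fintype.card_coe, two_mul,
          Nat.sub_add_comm (Finset.card_le_univ _)]

end Cylinder

section EdgeMap

variable {V W : Type*} {H : SimpleGraph W}

/-- The copy of `H` in a complete graph that is placed by an injective map on the vertices. -/
def copyTop (φ : W ↪ V) : SimpleGraph.Copy H (⊤ : SimpleGraph V) :=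
  (SimpleGraph.Embedding.completeGraph φ).toCopy.comp (SimpleGraph.Copy.ofLE H ⊤ le_top)

/-- The action of an injective vertex map on the edges of `H`. -/
def edgeMap (φ : W ↪ V) : H.edgeSet ↪ (⊤ : SimpleGraph V).edgeSet :=
  (copyTop φ).mapEdgeSet

theorem coe_edgeMap (φ : W ↪ V) (e : H.edgeSet) : (edgeMap φ e : Sym2 V) = Sym2.map φ e := rfl

end EdgeMap

namespace TemporalGraph

variable {V W : Type*} {H : SimpleGraph W} {P : H.edgeSet → H.edgeSet → Prop} {δ : ℝ}
  {L : (⊤ : SimpleGraph V).edgeSet → Finset ℕ+}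

theorem ContainsMotif.exists_embedding (h : (ofLabels L).ContainsMotif H P δ) :
    ∃ (φ : W ↪ V) (t : H.edgeSet → ℕ+), (∀ e, t e ∈ L (edgeMap φ e)) ∧
      (∀ e f, P e f → t e < t f) ∧ ∀ e f, ((t e : ℕ) : ℝ) - ((t f : ℕ) : ℝ) < δ := by
  obtain ⟨S, lab, Φ, hlab, hlt, hdiff⟩ := h
  choose t ht ht_eq using fun e => Finset.mem_image.mp (hlab (Φ.mapEdgeSet e))
  refine ⟨⟨fun w => (Φ w : V), Subtype.val_injective.comp Φ.injective⟩, t, fun e => ?_,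
    fun e f hef => ?_, fun e f => ?_⟩
  · convert ht e
    obtain ⟨⟨_, _⟩, _⟩ := e
    rfl
  · have := hlt e f hef
    rw [← ht_eq, ← ht_eq] at this
    exact_mod_cast this
  · rw [ht_eq, ht_eq]
    exact hdiff _ _

theorem containsMotif_ofLabels (φ : W ↪ V) (t : H.edgeSet → ℕ+) (ht : ∀ e, t e ∈ L (edgeMap φ e))
    (hlt : ∀ e f, P e f → t e < t f) (hdiff : ∀ e f, ((t e : ℕ) : ℝ) - ((t f : ℕ) : ℝ) < δ) :
    (ofLabels L).ContainsMotif H P δ := by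
  let Φ := (copyTop (H := H) φ).isoToSubgraph
  have t_symm_apply (e) : t (Φ.mapEdgeSet.symm (Φ.mapEdgeSet e)) = t e := by
    rw [Equiv.symm_apply_apply]
  refine ⟨(copyTop φ).toSubgraph, fun e => ((t (Φ.mapEdgeSet.symm e) : ℕ) : ℝ), Φ, fun e => ?_,
    fun e f hef => ?_, fun e f => hdiff _ _⟩
  · obtain ⟨e, rfl⟩ := Φ.mapEdgeSet.surjective e
    refine Finset.mem_image.mpr
      ⟨t e, ?_, congrArg (fun s : ℕ+ => ((s : ℕ) : ℝ)) (t_symm_apply e).symm⟩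
    convert ht e
    obtain ⟨⟨_, _⟩, _⟩ := e
    rfl
  · have := hlt e f hef
    rw [← t_symm_apply e, ← t_symm_apply f] at this
    exact Nat.cast_lt.mpr this

theorem ContainsMotif.coe_subgraph (h : (ofLabels L).ContainsMotif H P δ) (I : H.Subgraph) :
    (ofLabels L).ContainsMotif I.coe (fun _ _ => False) δ := by
  obtain ⟨φ, t, ht, -, hdiff⟩ := h.exists_embedding
  refine containsMotif_ofLabels ((Function.Embedding.subtype _).trans φ)
    (fun e => t (I.hom.mapEdgeSet e)) (fun e => ?_) (fun _ _ => False.elim) fun _ _ => hdiff _ _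
  convert ht (I.hom.mapEdgeSet e)
  obtain ⟨⟨_, _⟩, _⟩ := e
  rfl

end TemporalGraph

section EdgeSpan

variable {W : Type*} {H : SimpleGraph W}

theorem card_edgeSet_coe (I : H.Subgraph) [Fintype I.coe.edgeSet] :
    Fintype.card I.coe.edgeSet = I.edgeSet.ncard := by
  rw [← I.image_coe_edgeSet_coe, Set.ncard_image_of_injective _
    (Sym2.map.injective Subtype.val_injective), ← Nat.card_coe_set_eq, Nat.card_eq_fintype_card]

/-- The subgraph of `H` formed by a set of edges and the vertices incident to one of them. -/
def edgeSpan (J : Finset H.edgeSet) : H.Subgraph where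
  verts := {w | ∃ e ∈ J, w ∈ (e : Sym2 W)}
  Adj a b := ∃ e ∈ J, (e : Sym2 W) = s(a, b)
  adj_sub := by
    rintro a b ⟨e, -, he⟩
    exact (SimpleGraph.mem_edgeSet _).mp (he ▸ e.2)
  edge_vert := by
    rintro a b ⟨e, heJ, he⟩
    exact ⟨e, heJ, he ▸ Sym2.mem_mk_left a b⟩
  symm := ⟨fun _ _ ⟨e, heJ, he⟩ => ⟨e, heJ, he.trans Sym2.eq_swap⟩⟩

theorem edgeSet_edgeSpan (J : Finset H.edgeSet) :
    (edgeSpan J).edgeSet = Subtype.val '' (J : Set H.edgeSet) := by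
  ext ⟨a, b⟩
  simp [edgeSpan]

theorem ncard_edgeSet_edgeSpan (J : Finset H.edgeSet) : (edgeSpan J).edgeSet.ncard = J.card := by
  rw [edgeSet_edgeSpan, Set.ncard_image_of_injective _ Subtype.val_injective, Set.ncard_coe_finset]

theorem one_le_ncard_verts_edgeSpan [Finite W] {J : Finset H.edgeSet} (hJ : J.Nonempty) :
    1 ≤ (edgeSpan J).verts.ncard := by
  obtain ⟨e, he⟩ := hJ
  obtain ⟨w, hw⟩ : ∃ w, w ∈ (e : Sym2 W) := ⟨_, Sym2.out_fst_mem _⟩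
  exact (Set.ncard_pos).mpr ⟨w, e, he, hw⟩

theorem exists_subgraph_sparsity_mul_eq [Finite W] (hH : 2 ≤ H.edgeSet.ncard) :
    ∃ I : H.Subgraph, 2 ≤ I.edgeSet.ncard ∧
      sparsity H * (I.edgeSet.ncard - 1 : ℕ) = I.verts.ncard := by
  let ratio (I : H.Subgraph) : ℝ := (I.verts.ncard : ℝ) / ((I.edgeSet.ncard : ℝ) - 1)
  let S : Set ℝ := {x | ∃ I : H.Subgraph, 2 ≤ I.edgeSet.ncard ∧ x = ratio I}
  have hfin : S.Finite :=
    (Set.finite_range ratio).subset fun _ ⟨I, _, hx⟩ => ⟨I, hx.symm⟩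
  have hne : S.Nonempty := ⟨ratio ⊤, ⊤, by simpa using hH, rfl⟩
  obtain ⟨I, hI, hρ⟩ : sparsity H ∈ S := hne.csInf_mem hfin
  have : (2 : ℝ) ≤ I.edgeSet.ncard := by exact_mod_cast hI
  refine ⟨I, hI, ?_⟩
  rw [hρ, Nat.cast_sub (by lia), Nat.cast_one]
  exact div_mul_cancel₀ _ (by linarith)

theorem sparsity_le {I : H.Subgraph} (hI : 2 ≤ I.edgeSet.ncard) :
    sparsity H ≤ (I.verts.ncard : ℝ) / ((I.edgeSet.ncard : ℝ) - 1) := by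
  refine csInf_le ⟨0, ?_⟩ ⟨I, hI, rfl⟩
  rintro x ⟨J, hJ, rfl⟩
  have : (2 : ℝ) ≤ J.edgeSet.ncard := by exact_mod_cast hJ
  exact div_nonneg (by positivity) (by linarith)

theorem sparsity_mul_le (J : Finset H.edgeSet) :
    sparsity H * (J.card - 1 : ℕ) ≤ (edgeSpan J).verts.ncard := by
  obtain hJ | hJ := le_or_gt J.card 1
  · simp [Nat.sub_eq_zero_of_le hJ]
  have hle := sparsity_le ((ncard_edgeSet_edgeSpan J).symm ▸ hJ)
  have hpos : (1 : ℝ) < J.card := by exact_mod_cast hJ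
  rw [ncard_edgeSet_edgeSpan, le_div_iff₀ (by linarith)] at hle
  rwa [Nat.cast_sub hJ.le, Nat.cast_one]

end EdgeSpan

theorem exists_rank_lt_chainHeight {α : Type*} [Finite α] {r : α → α → Prop}
    (hr : IsStrictOrder α r) {h : ℕ} (hh : Set.chainHeight Set.univ r = h) :
    ∃ f : α → ℕ, (∀ a, f a < h) ∧ ∀ a b, r a b → f a < f b := by
  have height_ne_top (s : Set α) := Set.chainHeight_ne_top_of_finite s r s.toFinite
  have height_below_lt (a : α) (s : Set α) (hs : {x | r x a} ⊆ s) (ha : a ∈ s) :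
      Set.chainHeight {x | r x a} r + 1 ≤ Set.chainHeight s r := by
    obtain ⟨t, ht, hcard, hchain⟩ := Set.exists_eq_chainHeight_of_finite {x | r x a} r
      (Set.toFinite _)
    have hat : a ∉ t := fun h => irrefl a (ht h)
    rw [← hcard, ← Set.encard_insert_of_notMem hat]
    refine Set.encard_le_chainHeight_of_isChain _ _ (Set.insert_subset ha (ht.trans hs)) ?_
    exact hchain.insert fun b hb _ => Or.inr (ht hb)
  refine ⟨fun a => (Set.chainHeight {x | r x a} r).toNat, fun a => ?_, fun a b hab => ?_⟩
  · have := height_below_lt a Set.univ (Set.subset_univ _) (Set.mem_univ _)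
    rw [hh, ← ENat.natCast_toNat (height_ne_top {x | r x a})] at this
    exact_mod_cast this
  · have := height_below_lt a {x | r x b} (fun x hx => _root_.trans hx hab) hab
    rw [← ENat.natCast_toNat (height_ne_top {x | r x a}),
      ← ENat.natCast_toNat (height_ne_top {x | r x b})] at this
    exact_mod_cast this

section Counting

variable {V W : Type*}

open scoped Classical in
theorem card_embedding_mapsTo_le [Fintype V] [Fintype W] (U : Set W) (S : Set V) :
    ({φ | Set.MapsTo φ U S} : Finset (W ↪ V)).card ≤
      S.ncard ^ U.ncard * Fintype.card V ^ (Fintype.card W - U.ncard) := by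
  let box : Finset (W → V) :=
    Fintype.piFinset fun w => if w ∈ U then S.toFinset else Finset.univ
  have hbox : ({φ | Set.MapsTo φ U S} : Finset (W ↪ V)).card ≤ box.card := by
    refine Finset.card_le_card_of_injOn _ (fun φ hφ => ?_) DFunLike.coe_injective.injOn
    refine Finset.mem_coe.mpr (Fintype.mem_piFinset.mpr fun w => ?_)
    split_ifs with hw
    · exact Set.mem_toFinset.mpr ((Finset.mem_filter.mp hφ).2 hw)
    · exact Finset.mem_univ _
  refine hbox.trans_eq ?_
  simp only [box, Fintype.card_piFinset, apply_ite Finset.card, Finset.prod_ite,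
    Finset.prod_const, ← Set.ncard_eq_toFinset_card', Finset.card_univ]
  rw [Finset.filter_not, Finset.card_sdiff_of_subset (Finset.filter_subset _ _), Finset.card_univ,
    Set.ncard_eq_toFinset_card' U, Set.filter_mem_univ_eq_toFinset]

variable {H : SimpleGraph W} [Fintype H.edgeSet]

theorem mapsTo_verts_edgeSpan_sharedIndices (φ φ' : W ↪ V) :
    Set.MapsTo φ (edgeSpan (sharedIndices (edgeMap (H := H) φ) (edgeMap φ'))).verts
      (Set.range φ') := by
  rintro w ⟨e, he, hwe⟩
  obtain ⟨e', he'⟩ := mem_sharedIndices.mp he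
  have hmem : φ w ∈ Sym2.map φ' (e' : Sym2 W) := by
    rw [← coe_edgeMap, he', coe_edgeMap]
    exact Sym2.mem_map.mpr ⟨w, hwe, rfl⟩
  obtain ⟨u, -, hu⟩ := Sym2.mem_map.mp hmem
  exact ⟨u, hu⟩

open scoped Classical in
theorem card_sharedIndices_eq_le [Fintype V] [Fintype W] [Nonempty W] (J : Finset H.edgeSet) :
    ({p | sharedIndices (edgeMap (H := H) p.1) (edgeMap p.2) = J} :
        Finset ((W ↪ V) × (W ↪ V))).card ≤
      (Fintype.card W * Fintype.card V) ^ Fintype.card W *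
        Fintype.card V ^ (Fintype.card W - (edgeSpan J).verts.ncard) := by
  calc _ = ∑ φ' : W ↪ V,
        ({φ | sharedIndices (edgeMap (H := H) φ) (edgeMap φ') = J} : Finset (W ↪ V)).card := by
        simp only [Finset.card_filter, Fintype.sum_prod_type_right]
    _ ≤ ∑ φ' : W ↪ V, ({φ | Set.MapsTo φ (edgeSpan J).verts (Set.range φ')} :
          Finset (W ↪ V)).card := by
        gcongr with φ' _ φ
        rintro rfl
        exact mapsTo_verts_edgeSpan_sharedIndices φ φ'
    _ ≤ ∑ _φ' : W ↪ V, _ := Finset.sum_le_sum fun φ' _ =>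
        (card_embedding_mapsTo_le _ _).trans_eq (by
          rw [Set.ncard_range_of_injective φ'.injective, Nat.card_eq_fintype_card])
    _ ≤ _ := by
        rw [Finset.sum_const, smul_eq_mul, Finset.card_univ, Fintype.card_embedding_eq,
          ← mul_assoc, mul_pow, mul_comm (Fintype.card W ^ _)]
        gcongr
        · exact Nat.descFactorial_le_pow _ _
        · exact Fintype.card_pos
        · exact (Set.ncard_le_card _).trans_eq Nat.card_eq_fintype_card

end Counting

section Copies

variable {V W X κ : Type*} [Fintype V] [DecidableEq V] [Fintype W] {H : SimpleGraph W}
  [Fintype H.edgeSet] [MeasurableSpace X] {ν : Measure X} [IsProbabilityMeasure ν] {s : ℝ}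

open scoped Classical in
/-- The pairs of placements of `H` in the complete graph on `V` that have a common edge. -/
noncomputable def overlappingPairs (V : Type*) [Fintype V] (H : SimpleGraph W)
    [Fintype H.edgeSet] : Finset ((W ↪ V) × (W ↪ V)) :=
  {p | (sharedIndices (edgeMap (H := H) p.1) (edgeMap p.2)).Nonempty}

theorem pi_real_copy_inter_le {A A' : H.edgeSet → Set X} {φ φ' : W ↪ V}
    (h : (φ, φ') ∈ overlappingPairs V H → ∀ e e', Disjoint (A e) (A' e')) :
    (Measure.pi fun _ : (⊤ : SimpleGraph V).edgeSet => ν).real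
        (cylinderEvent (edgeMap φ) A ∩ cylinderEvent (edgeMap φ') A') ≤
      (Measure.pi fun _ : (⊤ : SimpleGraph V).edgeSet => ν).real (cylinderEvent (edgeMap φ) A) *
        (Measure.pi fun _ : (⊤ : SimpleGraph V).edgeSet => ν).real
          (cylinderEvent (edgeMap φ') A') := by
  by_cases hshare : ∃ e e' : H.edgeSet, edgeMap φ e = edgeMap φ' e'
  · have hoverlap : (φ, φ') ∈ overlappingPairs V H := by
      simpa [overlappingPairs] using sharedIndices_nonempty.mpr hshare
    rw [cylinderEvent_inter_eq_empty hshare (h hoverlap), measureReal_empty]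
    positivity
  · push Not at hshare
    rw [pi_real_cylinderEvent_inter (edgeMap φ).injective (edgeMap φ').injective hshare,
      pi_real_cylinderEvent (edgeMap φ).injective, pi_real_cylinderEvent (edgeMap φ').injective]

theorem sum_overlappingPairs_le [Nonempty W] (hs : 0 ≤ s) {A : H.edgeSet → Set X}
    (hA : ∀ e, ν.real (A e) = s) :
    ∑ p ∈ overlappingPairs V H, (Measure.pi fun _ : (⊤ : SimpleGraph V).edgeSet => ν).real
        (cylinderEvent (edgeMap p.1) A ∩ cylinderEvent (edgeMap p.2) A) ≤
      ∑ J : Finset H.edgeSet with J.Nonempty,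
        ((Fintype.card W * Fintype.card V : ℕ) : ℝ) ^ Fintype.card W *
        (Fintype.card V : ℝ) ^ (Fintype.card W - (edgeSpan J).verts.ncard) *
        s ^ (2 * Fintype.card H.edgeSet - J.card) := by
  classical
  calc _ ≤ ∑ p ∈ overlappingPairs V H, s ^ (2 * Fintype.card H.edgeSet -
          (sharedIndices (edgeMap (H := H) p.1) (edgeMap p.2)).card) :=
        Finset.sum_le_sum fun p _ => pi_real_cylinderEvent_inter_le (edgeMap p.1).injective
          (edgeMap p.2).injective hA
    _ = ∑ J : Finset H.edgeSet with J.Nonempty,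
          ∑ p ∈ overlappingPairs V H with
            sharedIndices (edgeMap p.1) (edgeMap p.2) = J,
              s ^ (2 * Fintype.card H.edgeSet - J.card) := by
        rw [← Finset.sum_fiberwise_of_maps_to
          (g := fun p => sharedIndices (edgeMap (H := H) p.1) (edgeMap p.2))
          (t := {J | J.Nonempty})
          fun p hp => by simpa [overlappingPairs] using hp]
        refine Finset.sum_congr rfl fun J _ => Finset.sum_congr rfl fun p hp => ?_
        rw [(Finset.mem_filter.mp hp).2]
    _ ≤ _ := by
        refine Finset.sum_le_sum fun J _ => ?_
        rw [Finset.sum_const, nsmul_eq_mul]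
        gcongr
        have hcard := (Finset.card_le_card (Finset.filter_subset_filter _
          (Finset.subset_univ (overlappingPairs V H)))).trans (card_sharedIndices_eq_le (V := V) J)
        exact_mod_cast hcard

variable [Fintype κ]

theorem measureReal_forall_notMem_copy_mul_sq_le [Nonempty W] (hs : 0 ≤ s)
    {B : κ → H.edgeSet → Set X} (hmeas : ∀ k e, MeasurableSet (B k e))
    (hB : ∀ k e, ν.real (B k e) = s)
    (hdisj : ∀ k k', k ≠ k' → ∀ e e', Disjoint (B k e) (B k' e')) :
    (Measure.pi fun _ : (⊤ : SimpleGraph V).edgeSet => ν).real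
        (⋂ i : κ × (W ↪ V), (cylinderEvent (edgeMap i.2) (B i.1))ᶜ) *
        (Fintype.card κ * (Fintype.card V).descFactorial (Fintype.card W) *
          s ^ Fintype.card H.edgeSet) ^ 2 ≤
      Fintype.card κ * ∑ J : Finset H.edgeSet with J.Nonempty,
        ((Fintype.card W * Fintype.card V : ℕ) : ℝ) ^ Fintype.card W *
        (Fintype.card V : ℝ) ^ (Fintype.card W - (edgeSpan J).verts.ncard) *
        s ^ (2 * Fintype.card H.edgeSet - J.card) := by
  classical
  set μ := Measure.pi fun _ : (⊤ : SimpleGraph V).edgeSet => ν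
  let E (i : κ × (W ↪ V)) := cylinderEvent (edgeMap i.2) (B i.1)
  let D : Finset ((κ × (W ↪ V)) × (κ × (W ↪ V))) :=
    (Finset.univ ×ˢ overlappingPairs V H).map
      ⟨fun q => ((q.1, q.2.1), (q.1, q.2.2)), fun _ _ h => by simp_all [Prod.ext_iff]⟩
  have hD (q) (hq : q ∉ D) : μ.real (E q.1 ∩ E q.2) ≤ μ.real (E q.1) * μ.real (E q.2) :=
    pi_real_copy_inter_le fun hoverlap => hdisj _ _ fun hk => hq (Finset.mem_map.mpr
      ⟨(q.1.1, q.1.2, q.2.2), by simpa using hoverlap, Prod.ext rfl (Prod.ext hk rfl)⟩)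
  have hmean : ∑ i, μ.real (E i) =
      Fintype.card κ * (Fintype.card V).descFactorial (Fintype.card W) *
        s ^ Fintype.card H.edgeSet := by
    simp only [← Fintype.card_embedding_eq, E, μ, pi_real_cylinderEvent (edgeMap _).injective, hB,
      Finset.prod_const, Finset.sum_const, Finset.card_univ, Fintype.card_prod, nsmul_eq_mul,
      Nat.cast_mul]
  rw [← hmean]
  have hE (i) : MeasurableSet (E i) := measurableSet_cylinderEvent _ (hmeas i.1)
  calc _ ≤ ∑ q ∈ D, μ.real (E q.1 ∩ E q.2) :=
        measureReal_iInter_compl_mul_sq_le (μ := μ) (E := E) hE D hD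
    _ = ∑ k, ∑ p ∈ overlappingPairs V H,
          μ.real (cylinderEvent (edgeMap p.1) (B k) ∩ cylinderEvent (edgeMap p.2) (B k)) := by
        rw [Finset.sum_map, Finset.sum_product]
        rfl
    _ ≤ ∑ _k : κ, _ := Finset.sum_le_sum fun k _ => sum_overlappingPairs_le hs (hB k)
    _ = _ := by rw [Finset.sum_const, nsmul_eq_mul, Finset.card_univ]

end Copies

section CopiesBound

theorem half_pow_le_descFactorial {n v : ℕ} (hn : 2 * v ≤ n) :
    ((n : ℝ) / 2) ^ v ≤ n.descFactorial v := by
  have hhalf : (n : ℝ) / 2 ≤ (n + 1 - v : ℕ) := by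
    have : (n : ℝ) ≤ (2 * (n + 1 - v) : ℕ) := Nat.cast_le.mpr (by lia)
    push_cast at this
    linarith
  calc ((n : ℝ) / 2) ^ v ≤ ((n + 1 - v : ℕ) : ℝ) ^ v := by gcongr
    _ ≤ n.descFactorial v := mod_cast Nat.pow_sub_le_descFactorial n v

-- The left side bounds the second moment contributed by the pairs of placements, in `K` windows,
-- that share `j` edges spanning `u` vertices; the first square on the right is the squared mean.
theorem pairs_term_eq_sq_mul {n v u m j : ℕ} {K s : ℝ} (hn : 0 < n) (hu : u ≤ v) (hj : 1 ≤ j)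
    (hjm : j ≤ m) (hK : 0 < K) (hs : 0 < s) :
    K * (((v * n : ℕ) : ℝ) ^ v * (n : ℝ) ^ (v - u) * s ^ (2 * m - j)) =
      (K * ((n : ℝ) / 2) ^ v * s ^ m) ^ 2 *
        ((4 * v : ℝ) ^ v / (K * s) * ((n : ℝ) ^ u * s ^ (j - 1))⁻¹) := by
  have hn' : (n : ℝ) ≠ 0 := by positivity
  have hfour : (4 : ℝ) ^ v = (2 ^ v) ^ 2 := by rw [← pow_mul, mul_comm, pow_mul]; norm_num
  rw [pow_sub₀ _ hn' hu, pow_sub₀ _ hs.ne' (by lia : j ≤ 2 * m), pow_sub₀ _ hs.ne' hj,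
    div_pow, Nat.cast_mul, mul_pow (v : ℝ),
    mul_pow (4 : ℝ), hfour]
  field_simp
  ring

variable {V W X κ : Type*} [Fintype V] [DecidableEq V] [Fintype W] [Nonempty W]
  {H : SimpleGraph W} [Fintype H.edgeSet] [MeasurableSpace X] {ν : Measure X}
  [IsProbabilityMeasure ν] [Fintype κ] [Nonempty κ] {s : ℝ}

theorem measureReal_forall_notMem_copy_le (hV : 2 * Fintype.card W ≤ Fintype.card V) (hs : 0 < s)
    {B : κ → H.edgeSet → Set X} (hmeas : ∀ k e, MeasurableSet (B k e))
    (hB : ∀ k e, ν.real (B k e) = s)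
    (hdisj : ∀ k k', k ≠ k' → ∀ e e', Disjoint (B k e) (B k' e')) :
    (Measure.pi fun _ : (⊤ : SimpleGraph V).edgeSet => ν).real
        (⋂ i : κ × (W ↪ V), (cylinderEvent (edgeMap i.2) (B i.1))ᶜ) ≤
      (4 * Fintype.card W : ℝ) ^ Fintype.card W / (Fintype.card κ * s) *
        ∑ J : Finset H.edgeSet with J.Nonempty,
          ((Fintype.card V : ℝ) ^ (edgeSpan J).verts.ncard * s ^ (J.card - 1))⁻¹ := by
  have hW : 0 < Fintype.card W := Fintype.card_pos
  have hκ : (0 : ℝ) < Fintype.card κ := mod_cast Fintype.card_pos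
  have hV' : 0 < Fintype.card V := by lia
  set Z := (Measure.pi fun _ : (⊤ : SimpleGraph V).edgeSet => ν).real
    (⋂ i : κ × (W ↪ V), (cylinderEvent (edgeMap i.2) (B i.1))ᶜ)
  set M : ℝ := Fintype.card κ * ((Fintype.card V : ℝ) / 2) ^ Fintype.card W *
    s ^ Fintype.card H.edgeSet
  have hM : 0 < M := by positivity
  refine le_of_mul_le_mul_right ?_ (pow_pos hM 2)
  calc Z * M ^ 2 ≤ Z * (Fintype.card κ * (Fintype.card V).descFactorial (Fintype.card W) *
          s ^ Fintype.card H.edgeSet) ^ 2 := by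
        gcongr Z * (_ * ?_ * _) ^ 2
        exact half_pow_le_descFactorial hV
    _ ≤ _ := measureReal_forall_notMem_copy_mul_sq_le hs.le hmeas hB hdisj
    _ = _ := by
        rw [mul_comm _ (M ^ 2), Finset.mul_sum, Finset.mul_sum, Finset.mul_sum]
        refine Finset.sum_congr rfl fun J hJ => pairs_term_eq_sq_mul hV' ?_ ?_ ?_ hκ hs
        · exact (Set.ncard_le_card _).trans_eq Nat.card_eq_fintype_card
        · exact (Finset.mem_filter.mp hJ).2.card_pos
        · exact Finset.card_le_univ J

end CopiesBound

section Labels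

/-- The label sets that have an element in `A`. -/
def hitting (A : Set ℕ+) : Set (Finset ℕ+) := {s | ∃ t ∈ s, t ∈ A}

theorem insert_mem_hitting {A : Set ℕ+} {t : ℕ+} {s : Finset ℕ+} :
    insert t s ∈ hitting A ↔ t ∈ A ∨ s ∈ hitting A := by
  simp [hitting]

theorem uniformLabel_toOuterMeasure (T : ℕ+) (A : Finset ℕ+) :
    (uniformLabel T).toOuterMeasure A =
      (Finset.Icc 1 T ∩ A).card * ((T : ℕ) : ℝ≥0∞)⁻¹ := by
  refine (PMF.toOuterMeasure_uniformOfFinset_apply _ _).trans ?_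
  simp [Finset.filter_mem_eq_inter, div_eq_mul_inv]

theorem uniformLabel_toOuterMeasure_le (T : ℕ+) (A : Finset ℕ+) :
    (uniformLabel T).toOuterMeasure A ≤ A.card * ((T : ℕ) : ℝ≥0∞)⁻¹ := by
  rw [uniformLabel_toOuterMeasure]
  gcongr
  exact Finset.inter_subset_right

theorem drawLabels_succ_hitting_le (T : ℕ+) (k : ℕ) (A : Set ℕ+) :
    (drawLabels T (k + 1)).toMeasure (hitting A) ≤
      (uniformLabel T).toOuterMeasure A + (drawLabels T k).toMeasure (hitting A) := by
  have hmap : ∀ t, ((drawLabels T k).map fun s => insert t s).toMeasure (hitting A) ≤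
      A.indicator 1 t + (drawLabels T k).toMeasure (hitting A) := by
    intro t
    rw [PMF.toMeasure_map_apply _ _ _ (measurable_of_countable _)
      (Set.to_countable _).measurableSet]
    by_cases ht : t ∈ A
    · simpa [ht] using prob_le_one.trans le_self_add
    · simp [ht, insert_mem_hitting, Set.preimage]
  rw [drawLabels, PMF.toMeasure_bind_apply _ _ _ (Set.to_countable _).measurableSet]
  calc _ ≤ ∑' t, uniformLabel T t * (A.indicator 1 t + (drawLabels T k).toMeasure (hitting A)) :=
        ENNReal.tsum_le_tsum fun t => mul_le_mul_right (hmap t) _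
    _ = (∑' t, uniformLabel T t * A.indicator 1 t) + (drawLabels T k).toMeasure (hitting A) := by
        simp only [mul_add, ENNReal.tsum_add, ENNReal.tsum_mul_right, PMF.tsum_coe, one_mul]
    _ = _ := by
        rw [PMF.toOuterMeasure_apply]
        congr 2 with t
        by_cases ht : t ∈ A <;> simp [ht]

theorem drawLabels_hitting_le (T : ℕ+) (k : ℕ) (A : Set ℕ+) :
    (drawLabels T k).toMeasure (hitting A) ≤ k * (uniformLabel T).toOuterMeasure A := by
  induction k with
  | zero =>
    rw [drawLabels, PMF.toMeasure_pure_apply _ _ (Set.to_countable _).measurableSet]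
    simp [hitting]
  | succ k ih =>
    rw [Nat.cast_succ, add_one_mul, add_comm (_ * _)]
    exact (drawLabels_succ_hitting_le T k A).trans (by gcongr)

theorem edgeLaw_hitting_le (ψ : PMF ℕ) (T : ℕ+) (A : Set ℕ+) :
    (edgeLaw ψ T).toMeasure (hitting A) ≤ labelMoment ψ 1 * (uniformLabel T).toOuterMeasure A := by
  rw [edgeLaw, PMF.toMeasure_bind_apply _ _ _ (Set.to_countable _).measurableSet, labelMoment,
    ← ENNReal.tsum_mul_right]
  refine ENNReal.tsum_le_tsum fun k => ?_
  rw [pow_one, mul_assoc]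
  exact mul_le_mul_right (drawLabels_hitting_le T k A) _

theorem toReal_toOuterMeasure_compl_zero_pos {ψ : PMF ℕ} (hψ : 0 < labelMoment ψ 1) :
    0 < (ψ.toOuterMeasure {0}ᶜ).toReal := by
  refine ENNReal.toReal_pos (fun h => hψ.ne' (ENNReal.tsum_eq_zero.mpr fun k => ?_)) ?_
  · rw [PMF.toOuterMeasure_apply_eq_zero_iff, Set.disjoint_left] at h
    obtain rfl | hk := eq_or_ne k 0
    · simp
    · rw [ψ.apply_eq_zero_iff k |>.mpr fun hk' => h hk' hk, zero_mul]
  · rw [PMF.toOuterMeasure_apply]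
    exact ψ.tsum_coe_indicator_ne_top _

end Labels

section FirstLabel

/-- The joint law of the set consisting of the first of `k` independent uniform labels (empty if
`k = 0`) and the set of values of the other labels. -/
noncomputable def splitDraw (T : ℕ+) : ℕ → PMF (Finset ℕ+ × Finset ℕ+)
  | 0 => PMF.pure (∅, ∅)
  | k + 1 => (uniformLabel T).bind fun t => (drawLabels T k).map fun s => ({t}, s)

/-- A coupling of the label set of an edge with its first label: `edgeLaw ψ T` is the law of the
union of the two components. -/
noncomputable def splitEdgeLaw (ψ : PMF ℕ) (T : ℕ+) : PMF (Finset ℕ+ × Finset ℕ+) :=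
  ψ.bind (splitDraw T)

/-- The event that a first label is present and belongs to `A`. -/
def firstLabelIn (A : Set ℕ+) : Set (Finset ℕ+ × Finset ℕ+) := {z | ∃ t ∈ A, z.1 = {t}}

theorem map_union_splitDraw (T : ℕ+) (k : ℕ) :
    (splitDraw T k).map (fun z => z.1 ∪ z.2) = drawLabels T k := by
  cases k with
  | zero => simp [splitDraw, drawLabels, PMF.pure_map]
  | succ k =>
    simp only [splitDraw, drawLabels, PMF.map_bind, PMF.map_comp, Function.comp_def,
      Finset.insert_eq]

theorem map_union_splitEdgeLaw (ψ : PMF ℕ) (T : ℕ+) :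
    (splitEdgeLaw ψ T).map (fun z => z.1 ∪ z.2) = edgeLaw ψ T := by
  simp only [splitEdgeLaw, edgeLaw, PMF.map_bind, map_union_splitDraw]

theorem pi_splitEdgeLaw_preimage_union {F : Type*} [Fintype F] (ψ : PMF ℕ) (T : ℕ+)
    (S : Set (F → Finset ℕ+)) :
    Measure.pi (fun _ : F => (splitEdgeLaw ψ T).toMeasure)
        ((fun z f => (z f).1 ∪ (z f).2) ⁻¹' S) =
      Measure.pi (fun _ : F => (edgeLaw ψ T).toMeasure) S := by
  have hunion : Measurable fun z : Finset ℕ+ × Finset ℕ+ => z.1 ∪ z.2 := measurable_of_countable _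
  rw [← map_union_splitEdgeLaw, ← PMF.toMeasure_map _ _ hunion,
    ← Measure.pi_map_pi fun _ => hunion.aemeasurable,
    Measure.map_apply (measurable_of_countable _) (Set.to_countable S).measurableSet]

theorem union_mem_hitting {A : Set ℕ+} {z : Finset ℕ+ × Finset ℕ+} (hz : z ∈ firstLabelIn A) :
    z.1 ∪ z.2 ∈ hitting A := by
  obtain ⟨t, ht, hz⟩ := hz
  exact ⟨t, by simp [hz], ht⟩

theorem disjoint_firstLabelIn {A B : Set ℕ+} (hAB : Disjoint A B) :
    Disjoint (firstLabelIn A) (firstLabelIn B) := by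
  refine Set.disjoint_left.mpr fun z ⟨t, ht, hz⟩ ⟨t', ht', hz'⟩ => ?_
  obtain rfl : t = t' := Finset.singleton_injective (hz.symm.trans hz')
  exact Set.disjoint_left.mp hAB ht ht'

theorem splitDraw_succ_firstLabelIn (T : ℕ+) (k : ℕ) (A : Set ℕ+) :
    (splitDraw T (k + 1)).toMeasure (firstLabelIn A) = (uniformLabel T).toOuterMeasure A := by
  rw [splitDraw, PMF.toMeasure_bind_apply _ _ _ (Set.to_countable _).measurableSet,
    PMF.toOuterMeasure_apply]
  refine tsum_congr fun t => ?_
  rw [PMF.toMeasure_map_apply _ _ _ (measurable_of_countable _) (Set.to_countable _).measurableSet]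
  by_cases ht : t ∈ A <;> simp [firstLabelIn, Set.preimage, ht]

theorem splitEdgeLaw_firstLabelIn (ψ : PMF ℕ) (T : ℕ+) (A : Set ℕ+) :
    (splitEdgeLaw ψ T).toMeasure (firstLabelIn A) =
      ψ.toOuterMeasure {0}ᶜ * (uniformLabel T).toOuterMeasure A := by
  rw [splitEdgeLaw, PMF.toMeasure_bind_apply _ _ _ (Set.to_countable _).measurableSet,
    PMF.toOuterMeasure_apply, ← ENNReal.tsum_mul_right]
  refine tsum_congr fun k => ?_
  cases k with
  | zero =>
    rw [splitDraw, PMF.toMeasure_pure_apply _ _ (Set.to_countable _).measurableSet]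
    simp [firstLabelIn]
  | succ k => rw [splitDraw_succ_firstLabelIn, Set.indicator_of_mem (by simp)]

end FirstLabel

section Windows

/-- The set of `m` consecutive labels `a + 1, …, a + m`. -/
def labelWindow (a m : ℕ) : Finset ℕ+ := Finset.Ico (Nat.succPNat a) (Nat.succPNat (a + m))

theorem card_labelWindow (a m : ℕ) : (labelWindow a m).card = m := by
  simp [labelWindow]

theorem mem_labelWindow {a m : ℕ} {t : ℕ+} :
    t ∈ labelWindow a m ↔ a < (t : ℕ) ∧ (t : ℕ) ≤ a + m := by
  rw [labelWindow, Finset.mem_Ico, ← PNat.coe_le_coe, ← PNat.coe_lt_coe, Nat.succPNat_coe,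
    Nat.succPNat_coe]
  lia

theorem labelWindow_subset_labelWindow {h b m w i : ℕ} (hi : i < h) (hm : h * m ≤ b) :
    labelWindow (w * b + i * m) m ⊆ labelWindow (w * b) b := by
  intro t ht
  have : (i + 1) * m ≤ h * m := Nat.mul_le_mul_right m hi
  rw [add_one_mul] at this
  rw [mem_labelWindow] at ht ⊢
  lia

theorem disjoint_labelWindow_of_le {a a' m m' : ℕ} (h : a + m ≤ a') :
    Disjoint (labelWindow a m) (labelWindow a' m') := by
  refine Finset.disjoint_left.mpr fun t ht ht' => ?_
  rw [mem_labelWindow] at ht ht'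
  lia

theorem pairwise_disjoint_labelWindow (b : ℕ) :
    Pairwise (Function.onFun Disjoint fun w => labelWindow (w * b) b) :=
  (pairwise_disjoint_on _).mpr fun w _ hlt => disjoint_labelWindow_of_le <|
    (Nat.succ_mul w b).symm.trans_le (Nat.mul_le_mul_right b hlt)

theorem labelWindow_subset_Icc {b w : ℕ} {T : ℕ+} (hw : w < (T : ℕ) / b) :
    labelWindow (w * b) b ⊆ Finset.Icc 1 T := by
  intro t ht
  have : (w + 1) * b ≤ T := (Nat.mul_le_mul_right b hw).trans (Nat.div_mul_le_self _ _)
  rw [add_one_mul] at this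
  rw [mem_labelWindow] at ht
  exact Finset.mem_Icc.mpr ⟨one_le, PNat.coe_le_coe _ _ |>.mp (by lia)⟩

end Windows

section FirstMoment

theorem pi_cylinderEvent_hitting_le {E F : Type*} [Fintype E] [Fintype F] {g : E → F}
    (hg : g.Injective) (ψ : PMF ℕ) (T : ℕ+) (A : E → Set ℕ+) :
    Measure.pi (fun _ : F => (edgeLaw ψ T).toMeasure) (cylinderEvent g fun e => hitting (A e)) ≤
      ∏ e, labelMoment ψ 1 * (uniformLabel T).toOuterMeasure (A e) := by
  rw [pi_cylinderEvent hg]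
  exact Finset.prod_le_prod' fun e _ => edgeLaw_hitting_le ψ T (A e)

variable {V W : Type*} {H : SimpleGraph W}

open scoped Classical in
/-- The label `s` for the edge `e₀`, and for every other edge a window of `2 * b` labels that
contains all labels at distance less than `b` from `s`, also when the subtraction `s - b` is
truncated. These are the possible labels of a `b`-temporal motif in which `e₀` receives `s`. -/
noncomputable def nearbyLabels (e₀ : H.edgeSet) (b : ℕ) (s : ℕ+) : H.edgeSet → Set ℕ+ :=
  Function.update (fun _ => labelWindow (s - b) (2 * b)) e₀ {s}

theorem mem_nearbyLabels {e₀ : H.edgeSet} {b : ℕ} {t : H.edgeSet → ℕ+}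
    (hdiff : ∀ e f, ((t e : ℕ) : ℝ) - ((t f : ℕ) : ℝ) < b) (e : H.edgeSet) :
    t e ∈ nearbyLabels e₀ b (t e₀) e := by
  classical
  obtain rfl | he := eq_or_ne e e₀
  · simp [nearbyLabels]
  have hlt (e f) : (t e : ℕ) < b + t f := by exact_mod_cast sub_lt_iff_lt_add.mp (hdiff e f)
  have := hlt e e₀
  have := hlt e₀ e
  have := (t e).pos
  rw [nearbyLabels, Function.update_of_ne he, Finset.mem_coe, mem_labelWindow]
  lia

theorem setOf_containsMotif_subset (e₀ : H.edgeSet) (P : H.edgeSet → H.edgeSet → Prop) (b : ℕ) :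
    {L : (⊤ : SimpleGraph V).edgeSet → Finset ℕ+ |
        (TemporalGraph.ofLabels L).ContainsMotif H P b} ⊆
      ⋃ (φ : W ↪ V) (s : ℕ+),
        cylinderEvent (edgeMap φ) fun e => hitting (nearbyLabels e₀ b s e) := by
  intro L hL
  obtain ⟨φ, t, ht, -, hdiff⟩ := TemporalGraph.ContainsMotif.exists_embedding hL
  exact Set.mem_iUnion₂.mpr ⟨φ, t e₀, fun e => ⟨t e, ht e, mem_nearbyLabels hdiff e⟩⟩

variable [Fintype H.edgeSet]

theorem pi_cylinderEvent_nearbyLabels_le {F : Type*} [Fintype F] {g : H.edgeSet → F}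
    (hg : g.Injective) (ψ : PMF ℕ) (T : ℕ+) (e₀ : H.edgeSet) (b : ℕ) (s : ℕ+) :
    Measure.pi (fun _ : F => (edgeLaw ψ T).toMeasure)
        (cylinderEvent g fun e => hitting (nearbyLabels e₀ b s e)) ≤
      labelMoment ψ 1 * uniformLabel T s *
        (labelMoment ψ 1 * ((2 * b : ℕ) * ((T : ℕ) : ℝ≥0∞)⁻¹)) ^ (Fintype.card H.edgeSet - 1) := by
  classical
  refine (pi_cylinderEvent_hitting_le hg ψ T _).trans ?_
  rw [← Finset.mul_prod_erase _ _ (Finset.mem_univ e₀), nearbyLabels, Function.update_self,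
    PMF.toOuterMeasure_apply_singleton, ← Finset.card_univ,
    ← Finset.card_erase_of_mem (Finset.mem_univ e₀)]
  gcongr
  refine Finset.prod_le_pow_card _ _ _ fun e he => ?_
  rw [Function.update_of_ne (Finset.ne_of_mem_erase he)]
  gcongr
  simpa only [card_labelWindow] using uniformLabel_toOuterMeasure_le T (labelWindow (s - b) (2 * b))

variable [Fintype V] [DecidableEq V] [Fintype W]

theorem pi_containsMotif_le (e₀ : H.edgeSet) (P : H.edgeSet → H.edgeSet → Prop) (ψ : PMF ℕ)
    (T : ℕ+) (b : ℕ) :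
    Measure.pi (fun _ : (⊤ : SimpleGraph V).edgeSet => (edgeLaw ψ T).toMeasure)
        {L | (TemporalGraph.ofLabels L).ContainsMotif H P b} ≤
      (Fintype.card V : ℝ≥0∞) ^ Fintype.card W * (labelMoment ψ 1 *
        (labelMoment ψ 1 * ((2 * b : ℕ) * ((T : ℕ) : ℝ≥0∞)⁻¹)) ^
          (Fintype.card H.edgeSet - 1)) := by
  set μ := Measure.pi (fun _ : (⊤ : SimpleGraph V).edgeSet => (edgeLaw ψ T).toMeasure)
  set q : ℝ≥0∞ := labelMoment ψ 1 * ((2 * b : ℕ) * ((T : ℕ) : ℝ≥0∞)⁻¹)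
  let C (φ : W ↪ V) (s : ℕ+) := cylinderEvent (edgeMap φ) fun e => hitting (nearbyLabels e₀ b s e)
  calc μ {L | (TemporalGraph.ofLabels L).ContainsMotif H P b}
      ≤ μ (⋃ (φ : W ↪ V) (s : ℕ+), C φ s) := measure_mono (setOf_containsMotif_subset e₀ P b)
    _ ≤ ∑ φ : W ↪ V, ∑' s : ℕ+, μ (C φ s) :=
        (measure_iUnion_fintype_le μ _).trans
          (Finset.sum_le_sum fun _ _ => measure_iUnion_le _)
    _ ≤ ∑ _φ : W ↪ V, ∑' s : ℕ+,
          labelMoment ψ 1 * uniformLabel T s * q ^ (Fintype.card H.edgeSet - 1) :=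
        Finset.sum_le_sum fun φ _ => ENNReal.tsum_le_tsum fun s =>
          pi_cylinderEvent_nearbyLabels_le (edgeMap φ).injective ψ T e₀ b s
    _ ≤ _ := by
        rw [Finset.sum_const, nsmul_eq_mul, ENNReal.tsum_mul_right, ENNReal.tsum_mul_left,
          PMF.tsum_coe, mul_one, Finset.card_univ, Fintype.card_embedding_eq]
        gcongr
        exact_mod_cast Nat.descFactorial_le_pow _ _

theorem pi_real_containsMotif_le (e₀ : H.edgeSet) (P : H.edgeSet → H.edgeSet → Prop) {ψ : PMF ℕ}
    (hψ : labelMoment ψ 1 ≠ ⊤) (T : ℕ+) (b : ℕ) :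
    (Measure.pi fun _ : (⊤ : SimpleGraph V).edgeSet => (edgeLaw ψ T).toMeasure).real
        {L | (TemporalGraph.ofLabels L).ContainsMotif H P b} ≤
      (labelMoment ψ 1).toReal * (2 * (labelMoment ψ 1).toReal) ^ (Fintype.card H.edgeSet - 1) *
        ((Fintype.card V : ℝ) ^ Fintype.card W *
          ((b : ℝ) / (T : ℕ)) ^ (Fintype.card H.edgeSet - 1)) := by
  refine (ENNReal.toReal_mono ?_ (pi_containsMotif_le e₀ P ψ T b)).trans_eq ?_
  · finiteness
  · simp only [ENNReal.toReal_mul, ENNReal.toReal_pow, ENNReal.toReal_natCast, ENNReal.toReal_inv,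
      Nat.cast_mul, Nat.cast_ofNat, ENNReal.toReal_ofNat, div_eq_mul_inv, mul_pow]
    ring

end FirstMoment

section SecondMoment

theorem div_le_two_mul_natDiv {a b : ℕ} (hb : 0 < b) (hba : b ≤ a) :
    (a : ℝ) / b ≤ 2 * (a / b : ℕ) := by
  have hdiv : a ≤ 2 * (a / b) * b := by
    have := Nat.div_add_mod' a b
    have := Nat.mod_lt a hb
    have := Nat.le_mul_of_pos_left b (Nat.div_pos hba hb)
    lia
  rw [div_le_iff₀ (Nat.cast_pos.mpr hb)]
  exact_mod_cast hdiv

theorem splitEdgeLaw_real_firstLabelIn (ψ : PMF ℕ) {T : ℕ+} {A : Finset ℕ+}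
    (hA : A ⊆ Finset.Icc 1 T) :
    (splitEdgeLaw ψ T).toMeasure.real (firstLabelIn A) =
      (ψ.toOuterMeasure {0}ᶜ).toReal * (A.card / (T : ℕ)) := by
  rw [measureReal_def, splitEdgeLaw_firstLabelIn, uniformLabel_toOuterMeasure,
    Finset.inter_eq_right.mpr hA]
  simp [div_eq_mul_inv]

variable {V W : Type*} {H : SimpleGraph W} {P : H.edgeSet → H.edgeSet → Prop} {r : H.edgeSet → ℕ}
  {h m b : ℕ}

theorem containsMotif_of_mem_cylinderEvent (hrh : ∀ e, r e < h) (hr : ∀ e f, P e f → r e < r f)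
    (hm : h * m ≤ b) {φ : W ↪ V} {w : ℕ} {L : (⊤ : SimpleGraph V).edgeSet → Finset ℕ+}
    (hL : L ∈ cylinderEvent (edgeMap φ) fun e => hitting (labelWindow (w * b + r e * m) m)) :
    (TemporalGraph.ofLabels L).ContainsMotif H P b := by
  choose t ht htw using hL
  refine TemporalGraph.containsMotif_ofLabels φ t ht (fun e f hef => ?_) fun e f => ?_
  · have he := mem_labelWindow.mp (htw e)
    have hf := mem_labelWindow.mp (htw f)
    have : (r e + 1) * m ≤ r f * m := Nat.mul_le_mul_right m (hr e f hef)
    rw [add_one_mul] at this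
    exact PNat.coe_lt_coe _ _ |>.mp (by lia)
  · have he := mem_labelWindow.mp (labelWindow_subset_labelWindow (hrh e) hm (htw e))
    have hf := mem_labelWindow.mp (labelWindow_subset_labelWindow (hrh f) hm (htw f))
    have : (t e : ℕ) < b + t f := by lia
    exact sub_lt_iff_lt_add.mpr (by exact_mod_cast this)

variable [Fintype V] [DecidableEq V] [Fintype W] [Nonempty W] [Fintype H.edgeSet] {ψ : PMF ℕ}
  {T : ℕ+}

theorem pi_real_not_containsMotif_le_div (hrh : ∀ e, r e < h) (hr : ∀ e f, P e f → r e < r f)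
    (hm : h * m ≤ b) (hb : 0 < b) (hbT : b ≤ T) (hV : 2 * Fintype.card W ≤ Fintype.card V) {s : ℝ}
    (hs : 0 < s) (hs_eq : (ψ.toOuterMeasure {0}ᶜ).toReal * (m / (T : ℕ)) = s) :
    (Measure.pi fun _ : (⊤ : SimpleGraph V).edgeSet => (edgeLaw ψ T).toMeasure).real
        {L | ¬ (TemporalGraph.ofLabels L).ContainsMotif H P b} ≤
      (4 * Fintype.card W : ℝ) ^ Fintype.card W / ((T / b : ℕ) * s) *
        ∑ J : Finset H.edgeSet with J.Nonempty,
          ((Fintype.card V : ℝ) ^ (edgeSpan J).verts.ncard * s ^ (J.card - 1))⁻¹ := by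
  have : Nonempty (Fin (T / b)) := Fin.pos_iff_nonempty.mp (Nat.div_pos hbT hb)
  let window (w : Fin (T / b)) (e : H.edgeSet) := labelWindow (w * b + r e * m) m
  have hwindow (w e) : window w e ⊆ labelWindow (w * b) b :=
    labelWindow_subset_labelWindow (hrh e) hm
  set μ := Measure.pi fun _ : (⊤ : SimpleGraph V).edgeSet => (splitEdgeLaw ψ T).toMeasure
  calc _ = μ.real ((fun z f => (z f).1 ∪ (z f).2) ⁻¹'
          {L | ¬ (TemporalGraph.ofLabels L).ContainsMotif H P b}) := by
        rw [measureReal_def, measureReal_def, pi_splitEdgeLaw_preimage_union]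
    _ ≤ μ.real (⋂ i : Fin (T / b) × (W ↪ V),
          (cylinderEvent (edgeMap i.2) fun e => firstLabelIn (window i.1 e))ᶜ) := by
        refine measureReal_mono fun z hz => Set.mem_iInter.mpr fun i hi => hz ?_
        exact containsMotif_of_mem_cylinderEvent hrh hr hm fun e => union_mem_hitting (hi e)
    _ ≤ (4 * Fintype.card W : ℝ) ^ Fintype.card W / (Fintype.card (Fin (T / b)) * s) *
        ∑ J : Finset H.edgeSet with J.Nonempty,
          ((Fintype.card V : ℝ) ^ (edgeSpan J).verts.ncard * s ^ (J.card - 1))⁻¹ := by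
        refine measureReal_forall_notMem_copy_le (B := fun w e => firstLabelIn (window w e)) hV hs
          (fun _ _ => (Set.to_countable _).measurableSet) (fun w e => ?_) fun w w' hw e e' => ?_
        · rw [splitEdgeLaw_real_firstLabelIn ψ ((hwindow w e).trans (labelWindow_subset_Icc w.2)),
            card_labelWindow, hs_eq]
        · refine disjoint_firstLabelIn (Finset.disjoint_coe.mpr ?_)
          exact (pairwise_disjoint_labelWindow b (Fin.val_ne_of_ne hw)).mono (hwindow w e)
            (hwindow w' e')
    _ = _ := by rw [Fintype.card_fin]

theorem pi_real_not_containsMotif_le (hrh : ∀ e, r e < h) (hr : ∀ e f, P e f → r e < r f)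
    (hh : 0 < h) (hhb : h ≤ b) (hbT : b ≤ T) (hV : 2 * Fintype.card W ≤ Fintype.card V) {θ : ℝ}
    (hθ : 0 < θ) (hθ_eq : (ψ.toOuterMeasure {0}ᶜ).toReal = θ) :
    (Measure.pi fun _ : (⊤ : SimpleGraph V).edgeSet => (edgeLaw ψ T).toMeasure).real
        {L | ¬ (TemporalGraph.ofLabels L).ContainsMotif H P b} ≤
      (4 * Fintype.card W : ℝ) ^ Fintype.card W / (θ / (4 * h)) *
        ∑ J : Finset H.edgeSet with J.Nonempty, ((Fintype.card V : ℝ) ^ (edgeSpan J).verts.ncard *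
          (θ / (2 * h) * ((b : ℝ) / (T : ℕ))) ^ (J.card - 1))⁻¹ := by
  have hb : 0 < b := hh.trans_le hhb
  have hm : (b : ℝ) / h ≤ 2 * (b / h : ℕ) := div_le_two_mul_natDiv hh hhb
  have hK : (T : ℕ) / (b : ℝ) ≤ 2 * ((T : ℕ) / b : ℕ) := div_le_two_mul_natDiv hb hbT
  set s : ℝ := θ * ((b / h : ℕ) / (T : ℕ))
  have hs_ge : θ / (2 * h) * ((b : ℝ) / (T : ℕ)) ≤ s := by
    calc _ = θ * ((b : ℝ) / h / 2 / (T : ℕ)) := by ring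
      _ ≤ θ * ((b / h : ℕ) / (T : ℕ)) := by gcongr; linarith
  have hs : 0 < s := lt_of_lt_of_le (by positivity) hs_ge
  have hKs : θ / (4 * h) ≤ ((T : ℕ) / b : ℕ) * s := by
    calc _ = (T : ℕ) / (b : ℝ) / 2 * (θ / (2 * h) * ((b : ℝ) / (T : ℕ))) := by field_simp; norm_num
      _ ≤ _ := by gcongr; linarith
  have hV' : 0 < Fintype.card V := by have := Fintype.card_pos (α := W); lia
  refine (pi_real_not_containsMotif_le_div hrh hr (Nat.mul_div_le b h) hb hbT hV hs
    (by rw [hθ_eq])).trans ?_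
  gcongr

end SecondMoment

section Limits

theorem tendsto_pow_mul_pow_zero {ρ : ℝ} {u k : ℕ} {s : ℕ → ℝ} (hk : k ≠ 0) (hρ : ρ * k = u)
    (hs : s =o[atTop] fun n : ℕ => (n : ℝ) ^ (-ρ)) :
    Tendsto (fun n : ℕ => (n : ℝ) ^ u * s n ^ k) atTop (𝓝 0) := by
  have hlim := hs.tendsto_div_nhds_zero.pow k
  rw [zero_pow hk] at hlim
  refine hlim.congr fun n => ?_
  have hn0 : (0 : ℝ) ≤ n := n.cast_nonneg
  rw [← Real.rpow_natCast n u, ← hρ, Real.rpow_mul hn0, Real.rpow_natCast, Real.rpow_neg hn0,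
    div_inv_eq_mul, mul_pow, mul_comm]

theorem tendsto_inv_pow_mul_pow_zero {ρ : ℝ} {u k : ℕ} {s : ℕ → ℝ} (hs_nonneg : ∀ n, 0 ≤ s n)
    (hu : u ≠ 0) (hρ : ρ * k ≤ u) (hs : (fun n : ℕ => (n : ℝ) ^ (-ρ)) =o[atTop] s) :
    Tendsto (fun n : ℕ => ((n : ℝ) ^ u * s n ^ k)⁻¹) atTop (𝓝 0) := by
  obtain rfl | hk := eq_or_ne k 0
  · simp only [pow_zero, mul_one]
    exact ((tendsto_pow_atTop hu).comp tendsto_natCast_atTop_atTop).inv_tendsto_atTop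
  have hlim := hs.tendsto_div_nhds_zero.pow k
  rw [zero_pow hk] at hlim
  refine squeeze_zero' (.of_forall fun n => ?_) ?_ hlim
  · have := hs_nonneg n
    positivity
  filter_upwards [eventually_gt_atTop 0] with n hn
  have hn0 : (0 : ℝ) < n := Nat.cast_pos.mpr hn
  have hpow : ((n : ℝ) ^ ρ) ^ k ≤ (n : ℝ) ^ u := by
    rw [← Real.rpow_natCast, ← Real.rpow_natCast, ← Real.rpow_mul hn0.le]
    exact Real.rpow_le_rpow_of_exponent_le (Nat.one_le_cast.mpr hn) hρ
  rw [mul_inv, Real.rpow_neg hn0.le, div_pow, inv_pow, div_eq_mul_inv]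
  have := hs_nonneg n
  gcongr

theorem tendsto_measure_compl_one {ι : Type*} {l : Filter ι} {Ω : ι → Type*}
    [∀ i, MeasurableSpace (Ω i)] {μ : ∀ i, Measure (Ω i)} [∀ i, IsProbabilityMeasure (μ i)]
    {S : ∀ i, Set (Ω i)} (hS : ∀ i, MeasurableSet (S i))
    (h : Tendsto (fun i => (μ i).real (S i)) l (𝓝 0)) :
    Tendsto (fun i => μ i (S i)ᶜ) l (𝓝 1) := by
  have := ENNReal.tendsto_ofReal (h.const_sub 1)
  rw [sub_zero, ENNReal.ofReal_one] at this
  exact this.congr fun i => by rw [← probReal_compl_eq_one_sub (hS i), ofReal_measureReal]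

theorem doublyRandom_apply {V : Type*} [Fintype V] [DecidableEq V] (ψ : PMF ℕ) (T : ℕ+)
    (S : Set (TemporalGraph V)) :
    doublyRandom V ψ T S =
      Measure.pi (fun _ : (⊤ : SimpleGraph V).edgeSet => (edgeLaw ψ T).toMeasure)
        {L | TemporalGraph.ofLabels L ∈ S} :=
  Measure.map_apply (fun _ _ => (Set.to_countable _).measurableSet) trivial

instance isProbabilityMeasure_doublyRandom {V : Type*} [Fintype V] [DecidableEq V] (ψ : PMF ℕ)
    (T : ℕ+) : IsProbabilityMeasure (doublyRandom V ψ T) :=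
  ⟨by rw [doublyRandom_apply]; simp⟩

variable {W : Type*} [Finite W] {H : SimpleGraph W} {P : H.edgeSet → H.edgeSet → Prop} {ψ : PMF ℕ}
  {β : ℕ → ℕ} {T : ℕ → ℕ+}

theorem tendsto_not_containsMotif_one (hH : 2 ≤ H.edgeSet.ncard) (hψ : labelMoment ψ 1 < ⊤)
    (hβT : (fun n : ℕ => (β n : ℝ) / ((T n : ℕ) : ℝ)) =o[atTop]
      fun n : ℕ => (n : ℝ) ^ (-sparsity H)) :
    Tendsto (fun n : ℕ => doublyRandom (Fin n) ψ (T n) {G | ¬ G.ContainsMotif H P (β n : ℝ)})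
      atTop (𝓝 1) := by
  obtain ⟨I, hI, hρ⟩ := exists_subgraph_sparsity_mul_eq hH
  have := Fintype.ofFinite I.verts
  have := Fintype.ofFinite I.coe.edgeSet
  obtain ⟨e₀⟩ : Nonempty I.coe.edgeSet :=
    Fintype.card_pos_iff.mp (by rw [card_edgeSet_coe]; lia)
  have hlim := (tendsto_pow_mul_pow_zero (by lia) hρ hβT).const_mul
    ((labelMoment ψ 1).toReal * (2 * (labelMoment ψ 1).toReal) ^ (I.edgeSet.ncard - 1))
  rw [mul_zero] at hlim
  refine tendsto_measure_compl_one (μ := fun n => doublyRandom (Fin n) ψ (T n))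
    (S := fun n => {G | G.ContainsMotif H P (β n : ℝ)}) (fun _ => trivial)
    (squeeze_zero (fun _ => measureReal_nonneg) (fun n => ?_) hlim)
  rw [measureReal_def, doublyRandom_apply, ← measureReal_def]
  refine (measureReal_mono fun L hL => ?_).trans ((pi_real_containsMotif_le e₀
    (fun _ _ => False) hψ.ne (T n) (β n)).trans_eq ?_)
  · exact TemporalGraph.ContainsMotif.coe_subgraph hL I
  · rw [card_edgeSet_coe, Fintype.card_fin, ← Nat.card_eq_fintype_card, Nat.card_coe_set_eq]

theorem tendsto_sum_edgeSpan_zero [Fintype H.edgeSet] {s : ℕ → ℝ} (hs_nonneg : ∀ n, 0 ≤ s n)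
    (hs : (fun n : ℕ => (n : ℝ) ^ (-sparsity H)) =o[atTop] s) :
    Tendsto (fun n : ℕ => ∑ J : Finset H.edgeSet with J.Nonempty,
      ((n : ℝ) ^ (edgeSpan J).verts.ncard * s n ^ (J.card - 1))⁻¹) atTop (𝓝 0) := by
  rw [← Finset.sum_const_zero (ι := Finset H.edgeSet)]
  refine tendsto_finsetSum _ fun J hJ => ?_
  have hverts := one_le_ncard_verts_edgeSpan (Finset.mem_filter.mp hJ).2
  exact tendsto_inv_pow_mul_pow_zero hs_nonneg (by lia) (sparsity_mul_le J) hs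

theorem tendsto_doublyRandom_real_not_containsMotif_zero [Nonempty H.edgeSet]
    (hP : IsStrictOrder H.edgeSet P) (hψ : 0 < labelMoment ψ 1)
    (hβ : ∀ᶠ n in atTop, Set.chainHeight Set.univ P ≤ (β n : ℕ∞))
    (hT : ∀ n, β n ≤ (T n : ℕ))
    (hβT : (fun n : ℕ => (n : ℝ) ^ (-sparsity H)) =o[atTop]
      fun n : ℕ => (β n : ℝ) / ((T n : ℕ) : ℝ)) :
    Tendsto (fun n : ℕ => (doublyRandom (Fin n) ψ (T n)).real
      {G | ¬ G.ContainsMotif H P (β n : ℝ)}) atTop (𝓝 0) := by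
  have := Fintype.ofFinite W
  have := Fintype.ofFinite H.edgeSet
  obtain ⟨e₀⟩ := ‹Nonempty H.edgeSet›
  have : Nonempty W := ⟨(e₀ : Sym2 W).out.1⟩
  obtain ⟨h, hh⟩ := ENat.ne_top_iff_exists.mp
    (Set.chainHeight_ne_top_of_finite Set.univ P Set.finite_univ)
  obtain ⟨r, hrh, hr⟩ := exists_rank_lt_chainHeight hP hh.symm
  have hh_pos : 0 < h := (Nat.zero_le _).trans_lt (hrh e₀)
  have hθ := toReal_toOuterMeasure_compl_zero_pos hψ
  generalize hθ_eq : (ψ.toOuterMeasure {0}ᶜ).toReal = θ at hθ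
  have hlim := (tendsto_sum_edgeSpan_zero (fun n => by positivity)
    (hβT.const_mul_right (show θ / (2 * h) ≠ 0 by positivity))).const_mul
      ((4 * Fintype.card W : ℝ) ^ Fintype.card W / (θ / (4 * h)))
  rw [mul_zero] at hlim
  refine squeeze_zero' (.of_forall fun _ => measureReal_nonneg) ?_ hlim
  filter_upwards [hβ, eventually_ge_atTop (2 * Fintype.card W)] with n hn hn'
  have hbound := pi_real_not_containsMotif_le (V := Fin n) hrh hr hh_pos
    (by exact_mod_cast hh.trans_le hn) (hT n) (by rwa [Fintype.card_fin]) hθ hθ_eq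
  rw [Fintype.card_fin] at hbound
  rwa [measureReal_def, doublyRandom_apply, ← measureReal_def]

theorem tendsto_containsMotif_one [Nonempty H.edgeSet] (hP : IsStrictOrder H.edgeSet P)
    (hψ : 0 < labelMoment ψ 1) (hβ : ∀ᶠ n in atTop, Set.chainHeight Set.univ P ≤ (β n : ℕ∞))
    (hT : ∀ n, β n ≤ (T n : ℕ))
    (hβT : (fun n : ℕ => (n : ℝ) ^ (-sparsity H)) =o[atTop]
      fun n : ℕ => (β n : ℝ) / ((T n : ℕ) : ℝ)) :
    Tendsto (fun n : ℕ => doublyRandom (Fin n) ψ (T n) {G | G.ContainsMotif H P (β n : ℝ)})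
      atTop (𝓝 1) := by
  simpa only [← Set.compl_ofPred, compl_compl] using
    tendsto_measure_compl_one (μ := fun n => doublyRandom (Fin n) ψ (T n))
      (S := fun n => {G | ¬ G.ContainsMotif H P (β n : ℝ)}) (fun _ => trivial)
      (tendsto_doublyRandom_real_not_containsMotif_zero hP hψ hβ hT hβT)

end Limits

theorem mainTheorem2_general {W : Type*} [Finite W] (H : SimpleGraph W)
    (hH : 2 ≤ H.edgeSet.ncard) (P : H.edgeSet → H.edgeSet → Prop) (ψ : PMF ℕ) (β : ℕ → ℕ)
    (T : ℕ → ℕ+) :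
    (IsStrictOrder H.edgeSet P → 0 < labelMoment ψ 1 →
      (∀ᶠ n in atTop, Set.chainHeight Set.univ P ≤ (β n : ℕ∞)) → (∀ n, β n ≤ (T n : ℕ)) →
      (fun n : ℕ => (n : ℝ) ^ (-sparsity H)) =o[atTop]
        (fun n : ℕ => (β n : ℝ) / ((T n : ℕ) : ℝ)) →
      Tendsto (fun n : ℕ => doublyRandom (Fin n) ψ (T n) {G | G.ContainsMotif H P (β n : ℝ)})
        atTop (𝓝 1)) ∧
    (labelMoment ψ 1 < ⊤ →
      (fun n : ℕ => (β n : ℝ) / ((T n : ℕ) : ℝ)) =o[atTop]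
        (fun n : ℕ => (n : ℝ) ^ (-sparsity H)) →
      Tendsto (fun n : ℕ => doublyRandom (Fin n) ψ (T n) {G | ¬ G.ContainsMotif H P (β n : ℝ)})
        atTop (𝓝 1)) := by
  have : Nonempty H.edgeSet := (Set.nonempty_of_ncard_ne_zero (by lia)).to_subtype
  exact ⟨tendsto_containsMotif_one, tendsto_not_containsMotif_one hH⟩

theorem mainTheorem2 {W : Type*} [Finite W] (H : SimpleGraph W) (hH : 2 ≤ H.edgeSet.ncard)
    (P : H.edgeSet → H.edgeSet → Prop) (hP : IsStrictOrder H.edgeSet P)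
    (ψ : PMF ℕ) (hψ : IsLabelMultiplicity ψ)
    (β : ℕ → ℕ) (T : ℕ → ℕ+)
    (hβ : ∃ n₀ > 0, ∀ n ≥ n₀, Set.chainHeight Set.univ P ≤ (β n : ℕ∞))
    (hT : ∀ n, β n ≤ (T n : ℕ)) :
    ((fun n : ℕ => (n : ℝ) ^ (-sparsity H)) =o[atTop]
        (fun n : ℕ => (β n : ℝ) / ((T n : ℕ) : ℝ)) →
      Tendsto (fun n : ℕ => doublyRandom (Fin n) ψ (T n) {G | G.ContainsMotif H P (β n : ℝ)})
        atTop (𝓝 1)) ∧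
    ((fun n : ℕ => (β n : ℝ) / ((T n : ℕ) : ℝ)) =o[atTop]
        (fun n : ℕ => (n : ℝ) ^ (-sparsity H)) →
      Tendsto (fun n : ℕ => doublyRandom (Fin n) ψ (T n) {G | ¬ G.ContainsMotif H P (β n : ℝ)})
        atTop (𝓝 1)) := by
  obtain ⟨n₀, -, hn₀⟩ := hβ
  obtain ⟨h_one, h_zero⟩ := mainTheorem2_general H hH P ψ β T
  exact ⟨h_one hP hψ.1.1 (eventually_atTop.mpr ⟨n₀, hn₀⟩) hT, h_zero hψ.1.2⟩
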